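/- Let $D$ be an integral domain with quotient field $K$. Let $\overline{F}(D)$ be the set of nonzero $D$-submodules of $K$, and $f(D)$ the set of finitely generated ones among them. A semistar operation of $D$ is a map $\star:\overline{F}(D)\to\overline{F}(D)$, $E\mapsto E^\star$, such that for all nonzero $x\in K$ and all $E,F\in\overline{F}(D)$: $(xE)^\star=xE^\star$; $E\subseteq F$ implies $E^\star\subseteq F^\star$; and $E\subseteq E^\star=(E^\star)^\star$. Semistar operations are ordered by: $\star_1\le\star_2$ if and only if $E^{\star_1}\subseteq E^{\star_2}$ for all $E$. The same terminology is used for $D[X]$ and its quotient field $K(X)$. Let $\star_f$ be the semistar operation $E^{\star_f}=\bigcup\{F^\star\mid F\in f(D),\ F\subseteq E\}$; $\star$ is of finite type if $\star=\star_f$, and stable if $(E\cap F)^\star=E^\star\cap F^\star$ for all $E,F\in\overline{F}(D)$. A quasi-$\star$-ideal is a nonzero ideal $I$ of $D$ with $I^\star\cap D=I$, and the maximal elements of the set of proper quasi-$\star$-ideals, which are prime ideals, are called quasi-$\star$-maximal ideals. Let $\tilde\star$ be the semistar operation $E^{\tilde\star}=\bigcap\{ED_P\mid P\text{ a quasi-}\star_f\text{-maximal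 ideal}\}$ (the empty intersection being $K$). A semistar operation $\bigstar$ of $D[X]$ is a strict extension of $\star$ if $(E[X])^{\bigstar}=E^\star[X]$ for all $E\in\overline{F}(D)$. For a nonzero $D[X]$-submodule $A$ of $K(X)$ with $A\subseteq K[X]$, let $c_D(A)$ be the $D$-submodule of $K$ generated by the coefficients of all the polynomials in $A$. For every $A\in\overline{F}(D[X])$ put $$A^{\blacktriangle^\star}=\bigcap\{z^{-1}\,c_D(zA)^\star[X]\mid 0\ne z\in K(X),\ zA\subseteq K[X]\},$$ the empty intersection being $K(X)$; this defines a semistar operation $\blacktriangle^\star$ of $D[X]$. Theorem. For every semistar operation $\star$ of $D$: 1. $(\blacktriangle^\star)_f=(\blacktriangle^{\star_f})_f$, and this is the largest element of the set of all strict extensions of $\star_f$ to $D[X]$ that are of finite type. 2. $\widetilde{\blacktriangle^\star}=\widetilde{\blacktriangle^{\tilde\star}}$, and this is the largest element of the set of all strict extensions of $\tilde\star$ to $D[X]$ that are stable and of finite type. -/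

import Mathlib

open Polynomial
open scoped Pointwise

noncomputable section

/-- The set of all nonzero `D`-submodules of `K`. -/
abbrev NonzeroSubmodule (D K : Type*) [CommRing D] [Field K] [Algebra D K] : Type _ :=
  {E : Submodule D K // E ≠ ⊥}

namespace NonzeroSubmodule

variable {D K : Type*} [CommRing D] [Field K] [Algebra D K]

/-- The submodule `x E = {x e | e ∈ E}`, for a nonzero `x` in `K`. -/
def dilate (x : K) (hx : x ≠ 0) (E : NonzeroSubmodule D K) : NonzeroSubmodule D K :=
  ⟨x • E.1, fun h => E.2 (by
    have := congrArg (fun M : Submodule D K => x⁻¹ • M) h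
    simpa [smul_smul, inv_mul_cancel₀ hx] using this)⟩

theorem mem_dilate {x : K} {hx : x ≠ 0} {E : NonzeroSubmodule D K} {y : K} :
    y ∈ (E.dilate x hx).1 ↔ x⁻¹ * y ∈ E.1 := by
  constructor
  · rintro ⟨e, he, rfl⟩
    simpa [hx] using he
  · intro h
    exact ⟨x⁻¹ * y, h, by simp [hx]⟩

theorem inf_ne_bot [IsFractionRing D K] (E F : NonzeroSubmodule D K) : E.1 ⊓ F.1 ≠ ⊥ := by
  have hD : IsDomain D := (IsFractionRing.injective D K).isDomain
  obtain ⟨x, hx, hx0⟩ := Submodule.exists_mem_ne_zero_of_ne_bot E.2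
  obtain ⟨y, hy, hy0⟩ := Submodule.exists_mem_ne_zero_of_ne_bot F.2
  obtain ⟨a, b, hb, hab⟩ := IsFractionRing.div_surjective (A := D) (x / y)
  have hb0 : algebraMap D K b ≠ 0 := IsFractionRing.to_map_ne_zero_of_mem_nonZeroDivisors hb
  have key : b • x = a • y := by
    rw [Algebra.smul_def, Algebra.smul_def]
    rw [div_eq_div_iff hb0 hy0] at hab
    linear_combination -hab
  refine (Submodule.ne_bot_iff _).2 ⟨b • x, ⟨E.1.smul_mem b hx, ?_⟩, ?_⟩
  · rw [key]
    exact F.1.smul_mem a hy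
  · rw [Algebra.smul_def]
    exact mul_ne_zero hb0 hx0

/-- The intersection of two nonzero `D`-submodules of the quotient field `K` (again nonzero). -/
def inter [IsFractionRing D K] (E F : NonzeroSubmodule D K) : NonzeroSubmodule D K :=
  ⟨E.1 ⊓ F.1, inf_ne_bot E F⟩

/-- A nonzero ideal of `D`, viewed as a `D`-submodule of `K`. -/
def ofIdeal [IsFractionRing D K] (I : Ideal D) (hI : I ≠ ⊥) : NonzeroSubmodule D K :=
  ⟨Submodule.map (Algebra.linearMap D K) I, fun h => hI (by
    refine Submodule.map_injective_of_injective (f := Algebra.linearMap D K)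
      (IsFractionRing.injective D K) ?_
    rw [h, Submodule.map_bot])⟩

end NonzeroSubmodule

/-- A semistar operation of `D`, where `K` is the quotient field of `D`. -/
@[ext]
structure SemistarOperation (D K : Type*) [CommRing D] [Field K] [Algebra D K] where
  toFun : NonzeroSubmodule D K → NonzeroSubmodule D K
  map_dilate : ∀ (x : K) (hx : x ≠ 0) (E : NonzeroSubmodule D K),
    toFun (E.dilate x hx) = (toFun E).dilate x hx
  mono : ∀ E F : NonzeroSubmodule D K, E ≤ F → toFun E ≤ toFun F
  le_map : ∀ E : NonzeroSubmodule D K, E ≤ toFun E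
  idem : ∀ E : NonzeroSubmodule D K, toFun (toFun E) = toFun E

namespace SemistarOperation

section General

variable {D K : Type*} [CommRing D] [Field K] [Algebra D K]

instance : CoeFun (SemistarOperation D K)
    (fun _ => NonzeroSubmodule D K → NonzeroSubmodule D K) := ⟨toFun⟩

/-- `S ≤ T` means `E^S ⊆ E^T` for every nonzero submodule `E`. -/
instance : PartialOrder (SemistarOperation D K) :=
  PartialOrder.lift toFun (fun _ _ h => SemistarOperation.ext h)

/-- The semistar operation of finite type associated to `S`:
`E` is sent to the union of the `F^S`, for `F` nonzero, finitely generated and contained in `E`. -/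
def finType (S : SemistarOperation D K) : SemistarOperation D K where
  toFun E :=
    ⟨{ carrier := {x | ∃ F : NonzeroSubmodule D K, F.1.FG ∧ F ≤ E ∧ x ∈ (S F).1}
       zero_mem' := by
         obtain ⟨x, hx, hx0⟩ := Submodule.exists_mem_ne_zero_of_ne_bot E.2
         refine ⟨⟨Submodule.span D {x}, by simpa using hx0⟩, Submodule.fg_span_singleton x, ?_,
           Submodule.zero_mem _⟩
         exact (Submodule.span_singleton_le_iff_mem _ _).2 hx
       add_mem' := by
         rintro x y ⟨F, hF, hFE, hx⟩ ⟨G, hG, hGE, hy⟩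
         let H : NonzeroSubmodule D K := ⟨F.1 ⊔ G.1, fun h => F.2 (sup_eq_bot_iff.1 h).1⟩
         have h1 : F ≤ H := Subtype.coe_le_coe.1 le_sup_left
         have h2 : G ≤ H := Subtype.coe_le_coe.1 le_sup_right
         exact ⟨H, hF.sup hG, Subtype.coe_le_coe.1 (sup_le hFE hGE),
           Submodule.add_mem _ (S.mono _ _ h1 hx) (S.mono _ _ h2 hy)⟩
       smul_mem' := by
         rintro d x ⟨F, hF, hFE, hx⟩
         exact ⟨F, hF, hFE, Submodule.smul_mem _ d hx⟩ }, by
      obtain ⟨x, hx, hx0⟩ := Submodule.exists_mem_ne_zero_of_ne_bot E.2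
      refine (Submodule.ne_bot_iff _).2 ⟨x, ⟨⟨Submodule.span D {x}, by simpa using hx0⟩,
        Submodule.fg_span_singleton x, ?_, ?_⟩, hx0⟩
      · exact (Submodule.span_singleton_le_iff_mem _ _).2 hx
      · exact S.le_map _ (Submodule.mem_span_singleton_self x)⟩
  map_dilate x hx E := by
    have key : ∀ (x : K) (hx : x ≠ 0) (E : NonzeroSubmodule D K) (y : K),
        (∃ F : NonzeroSubmodule D K, F.1.FG ∧ F ≤ E ∧ y ∈ (S F).1) →
        ∃ F : NonzeroSubmodule D K, F.1.FG ∧ F ≤ E.dilate x hx ∧ x * y ∈ (S F).1 := by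
      rintro x hx E y ⟨F, hF, hFE, hy⟩
      refine ⟨F.dilate x hx, ?_, ?_, ?_⟩
      · exact hF.map _
      · intro z hz
        rw [NonzeroSubmodule.mem_dilate] at hz ⊢
        exact hFE hz
      · rw [S.map_dilate, NonzeroSubmodule.mem_dilate]
        simpa [hx] using hy
    have hE : (E.dilate x hx).dilate x⁻¹ (inv_ne_zero hx) = E := by
      ext y
      rw [NonzeroSubmodule.mem_dilate, NonzeroSubmodule.mem_dilate]
      simp [hx]
    ext y
    rw [NonzeroSubmodule.mem_dilate]
    constructor
    · intro h
      have := key x⁻¹ (inv_ne_zero hx) _ _ h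
      rw [hE] at this
      exact this
    · intro h
      have := key x hx _ _ h
      simpa [hx] using this
  mono E F h := by
    rintro x ⟨G, hG, hGE, hx⟩
    exact ⟨G, hG, hGE.trans h, hx⟩
  le_map E := by
    intro x hx
    by_cases hx0 : x = 0
    · rw [hx0]
      exact Submodule.zero_mem _
    · refine ⟨⟨Submodule.span D {x}, by simpa using hx0⟩, Submodule.fg_span_singleton x, ?_,
        S.le_map _ (Submodule.mem_span_singleton_self x)⟩
      exact (Submodule.span_singleton_le_iff_mem _ _).2 hx
  idem E := by
    apply le_antisymm
    · rintro x ⟨F, ⟨s, hs⟩, hFE, hx⟩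
      -- finitely many generators of `F` lie in a single `G^S`
      have key : ∀ t : Finset K, (∀ y ∈ t, ∃ G : NonzeroSubmodule D K,
          G.1.FG ∧ G ≤ E ∧ y ∈ (S G).1) →
          ∃ G : NonzeroSubmodule D K, G.1.FG ∧ G ≤ E ∧ ∀ y ∈ t, y ∈ (S G).1 := by
        classical
        intro t
        induction t using Finset.induction_on with
        | empty =>
          intro _
          obtain ⟨x, hx, hx0⟩ := Submodule.exists_mem_ne_zero_of_ne_bot E.2
          refine ⟨⟨Submodule.span D {x}, by simpa using hx0⟩, Submodule.fg_span_singleton x, ?_,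
            by simp⟩
          exact (Submodule.span_singleton_le_iff_mem _ _).2 hx
        | insert a t _ ih =>
          intro h
          obtain ⟨G, hG, hGE, hGt⟩ := ih (fun y hy => h y (Finset.mem_insert_of_mem hy))
          obtain ⟨F, hF, hFE, hFa⟩ := h a (Finset.mem_insert_self _ _)
          let H : NonzeroSubmodule D K := ⟨F.1 ⊔ G.1, fun h => F.2 (sup_eq_bot_iff.1 h).1⟩
          have h1 : F ≤ H := Subtype.coe_le_coe.1 le_sup_left
          have h2 : G ≤ H := Subtype.coe_le_coe.1 le_sup_right
          refine ⟨H, hF.sup hG, Subtype.coe_le_coe.1 (sup_le hFE hGE), fun y hy => ?_⟩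
          rcases Finset.mem_insert.1 hy with rfl | hy
          · exact S.mono _ _ h1 hFa
          · exact S.mono _ _ h2 (hGt y hy)
      obtain ⟨G, hG, hGE, hGs⟩ := key s (fun y hy => hFE (by
        rw [← hs]
        exact Submodule.subset_span hy))
      refine ⟨G, hG, hGE, ?_⟩
      have hFG : F ≤ S G := by
        refine Subtype.coe_le_coe.1 ?_
        rw [← hs]
        exact Submodule.span_le.2 hGs
      rw [← S.idem G]
      exact S.mono _ _ hFG hx
    · rintro x ⟨F, hF, hFE, hx⟩
      refine ⟨F, hF, ?_, hx⟩
      exact fun y hy => ⟨F, hF, hFE, S.le_map F hy⟩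

/-- A semistar operation is of finite type if it equals the associated one of finite type. -/
def IsFiniteType (S : SemistarOperation D K) : Prop := S = S.finType

/-- The submodule `E D_P` of `K`: all the fractions `e / s` with `e ∈ E` and `s ∈ D ∖ P`. -/
def localize (P : PrimeSpectrum D) (E : Submodule D K) : Submodule D K where
  carrier := {x | ∃ s : D, s ∉ P.asIdeal ∧ s • x ∈ E}
  zero_mem' := ⟨1, P.asIdeal.primeCompl.one_mem, by simp⟩
  add_mem' := by
    rintro x y ⟨s, hs, hx⟩ ⟨t, ht, hy⟩
    refine ⟨s * t, P.asIdeal.primeCompl.mul_mem hs ht, ?_⟩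
    rw [smul_add]
    refine E.add_mem ?_ ?_
    · rw [mul_comm, mul_smul]
      exact E.smul_mem _ hx
    · rw [mul_smul]
      exact E.smul_mem _ hy
  smul_mem' := by
    rintro d x ⟨s, hs, hx⟩
    refine ⟨s, hs, ?_⟩
    rw [smul_comm]
    exact E.smul_mem _ hx

/-- The spectral semistar operation associated to a set `Δ` of prime ideals:
`E` is sent to the intersection of the `E D_P`, `P ∈ Δ` (which is `K` if `Δ` is empty). -/
def spectral (Δ : Set (PrimeSpectrum D)) : SemistarOperation D K where
  toFun E := ⟨⨅ P ∈ Δ, localize P E.1, by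
    obtain ⟨x, hx, hx0⟩ := Submodule.exists_mem_ne_zero_of_ne_bot E.2
    refine (Submodule.ne_bot_iff _).2 ⟨x, ?_, hx0⟩
    simp only [Submodule.mem_iInf]
    exact fun P _ => ⟨1, P.asIdeal.primeCompl.one_mem, by simpa using hx⟩⟩
  map_dilate x hx E := by
    ext y
    rw [NonzeroSubmodule.mem_dilate]
    simp only [Submodule.mem_iInf]
    refine forall₂_congr fun P _ => exists_congr fun s => and_congr_right fun _ => ?_
    rw [NonzeroSubmodule.mem_dilate, mul_smul_comm]
  mono E F h := by
    refine Subtype.coe_le_coe.1 (iInf₂_mono fun P _ => ?_)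
    rintro x ⟨s, hs, hx⟩
    exact ⟨s, hs, h hx⟩
  le_map E := by
    refine Subtype.coe_le_coe.1 (le_iInf₂ fun P _ x hx => ?_)
    exact ⟨1, P.asIdeal.primeCompl.one_mem, by simpa using hx⟩
  idem E := by
    apply le_antisymm
    · refine Subtype.coe_le_coe.1 (iInf₂_mono fun P hP => ?_)
      rintro x ⟨s, hs, hx⟩
      simp only [Submodule.mem_iInf] at hx
      obtain ⟨t, ht, hx⟩ := hx P hP
      exact ⟨t * s, P.asIdeal.primeCompl.mul_mem ht hs, by rwa [mul_smul]⟩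
    · refine Subtype.coe_le_coe.1 (le_iInf₂ fun P _ x hx => ?_)
      exact ⟨1, P.asIdeal.primeCompl.one_mem, by simpa using hx⟩

variable [IsFractionRing D K]

/-- A semistar operation is stable if it commutes with the intersection of two submodules. -/
def IsStable (S : SemistarOperation D K) : Prop :=
  ∀ E F : NonzeroSubmodule D K, S (E.inter F) = (S E).inter (S F)

/-- A quasi-`S`-ideal: a nonzero integral ideal `I` of `D` with `I^S ∩ D = I`. -/
def IsQuasiIdeal (S : SemistarOperation D K) (I : Ideal D) : Prop :=
  ∃ hI : I ≠ ⊥, (S (NonzeroSubmodule.ofIdeal I hI)).1.comap (Algebra.linearMap D K) = I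

/-- A quasi-`S`-maximal ideal: a maximal element of the set of proper quasi-`S`-ideals. -/
def IsQuasiMaximal (S : SemistarOperation D K) (I : Ideal D) : Prop :=
  Maximal (fun J : Ideal D => S.IsQuasiIdeal J ∧ J ≠ ⊤) I

theorem IsQuasiMaximal.isPrime {S : SemistarOperation D K} {P : Ideal D}
    (h : S.IsQuasiMaximal P) : P.IsPrime := by
  obtain ⟨⟨⟨hP0, hP⟩, hPtop⟩, hmax⟩ := h
  refine ⟨hPtop, fun {a b} hab => ?_⟩
  by_contra hcon
  rw [not_or] at hcon
  obtain ⟨ha, hb⟩ := hcon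
  have haK : algebraMap D K a ≠ 0 := by
    intro h0
    rw [(map_eq_zero_iff _ (IsFractionRing.injective D K)).1 h0] at ha
    exact ha P.zero_mem
  let Q : Ideal D := Submodule.comap (LinearMap.mulLeft D a) P
  have hmem : ∀ d, d ∈ Q ↔ a * d ∈ P := fun _ => Iff.rfl
  have hPQ : P ≤ Q := fun d hd => P.mul_mem_left a hd
  have hQ0 : Q ≠ ⊥ := fun h0 => hP0 (le_bot_iff.1 (h0 ▸ hPQ))
  refine hb (hmax ⟨⟨hQ0, ?_⟩, ?_⟩ hPQ ((hmem b).2 hab))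
  · refine le_antisymm (fun d hd => ?_) (fun d hd => S.le_map _ ⟨d, hd, rfl⟩)
    rw [hmem, ← hP]
    have hle : (NonzeroSubmodule.ofIdeal (K := K) Q hQ0).dilate (algebraMap D K a) haK ≤
        NonzeroSubmodule.ofIdeal P hP0 := by
      rintro _ ⟨_, ⟨q, hq, rfl⟩, rfl⟩
      exact ⟨a * q, hq, by simp⟩
    refine S.mono _ _ hle ?_
    rw [S.map_dilate]
    exact ⟨algebraMap D K d, hd, by simp⟩
  · intro htop
    exact ha (by simpa using (hmem 1).1 (htop ▸ Submodule.mem_top))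

/-- The stable semistar operation of finite type associated to `S`: the spectral semistar
operation associated to the set of quasi-maximal ideals of the finite-type operation `S.finType`.
(A quasi-maximal ideal is always prime.) -/
def stableFinType (S : SemistarOperation D K) : SemistarOperation D K :=
  spectral {P : PrimeSpectrum D | S.finType.IsQuasiMaximal P.asIdeal}

end General

end SemistarOperation

/-- `D[X] → K[X]` is the coefficientwise map. Through it, `D[X]` acts on the field `K(X)`. -/
instance (priority := 100) polynomialBaseAlgebra (D K : Type*) [CommRing D] [Field K]
    [Algebra D K] : Algebra D[X] K[X] :=
  Polynomial.algebra D K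

section PolynomialRing

variable {D K : Type*} [CommRing D] [Field K] [Algebra D K]

instance ratFunc_isFractionRing [IsFractionRing D K] : IsFractionRing D[X] (RatFunc K) := by
  have hD : IsDomain D := (IsFractionRing.injective D K).isDomain
  have htower : ∀ p : D[X], algebraMap D[X] (RatFunc K) p =
      algebraMap K[X] (RatFunc K) (p.map (algebraMap D K)) := fun p => by
    rw [IsScalarTower.algebraMap_apply D[X] K[X] (RatFunc K)]
    rfl
  have hinj : Function.Injective (algebraMap D[X] (RatFunc K)) := by
    intro p q h
    rw [htower, htower] at h
    exact Polynomial.map_injective _ (IsFractionRing.injective D K)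
      (IsFractionRing.injective K[X] (RatFunc K) h)
  have : FaithfulSMul D[X] (RatFunc K) := (faithfulSMul_iff_algebraMap_injective _ _).2 hinj
  refine IsFractionRing.of_field D[X] (RatFunc K) fun z => ?_
  obtain ⟨p, q, hq, rfl⟩ := IsFractionRing.div_surjective (A := K[X]) z
  obtain ⟨a, ha0, ha⟩ := IsLocalization.integerNormalization_spec (nonZeroDivisors D) p
  obtain ⟨b, hb0, hb⟩ := IsLocalization.integerNormalization_spec (nonZeroDivisors D) q
  have haK : algebraMap D K a ≠ 0 := IsFractionRing.to_map_ne_zero_of_mem_nonZeroDivisors ha0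
  have hbK : algebraMap D K b ≠ 0 := IsFractionRing.to_map_ne_zero_of_mem_nonZeroDivisors hb0
  have hC : ∀ (c : D) (r : K[X]), c • r = C (algebraMap D K c) * r := fun c r => by
    rw [← Polynomial.smul_eq_C_mul, algebraMap_smul]
  have hC0 : ∀ c : K, c ≠ 0 → algebraMap K[X] (RatFunc K) (C c) ≠ 0 := fun c hc => by
    simpa using hc
  have hq0 : algebraMap K[X] (RatFunc K) q ≠ 0 :=
    IsFractionRing.to_map_ne_zero_of_mem_nonZeroDivisors hq
  refine ⟨C b * IsLocalization.integerNormalization (nonZeroDivisors D) p,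
    C a * IsLocalization.integerNormalization (nonZeroDivisors D) q, ?_⟩
  rw [htower, htower, Polynomial.map_mul, Polynomial.map_mul, ha, hb, hC, hC, Polynomial.map_C,
    Polynomial.map_C, map_mul, map_mul, map_mul, map_mul]
  have h1 := hC0 _ haK
  have h2 := hC0 _ hbK
  rw [div_eq_div_iff hq0 (mul_ne_zero h1 (mul_ne_zero h2 hq0))]
  ring

/-- The submodule `E[X]` of `K(X)`: the polynomials all of whose coefficients lie in `E`. -/
def polyExtension (E : Submodule D K) : Submodule D[X] (RatFunc K) where
  carrier := {f | ∃ p : K[X], (∀ n, p.coeff n ∈ E) ∧ algebraMap K[X] (RatFunc K) p = f}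
  zero_mem' := ⟨0, by simp⟩
  add_mem' := by
    rintro _ _ ⟨p, hp, rfl⟩ ⟨q, hq, rfl⟩
    exact ⟨p + q, fun n => by simpa using E.add_mem (hp n) (hq n), by simp⟩
  smul_mem' := by
    rintro g _ ⟨p, hp, rfl⟩
    refine ⟨g • p, fun n => ?_, ?_⟩
    · rw [Algebra.smul_def, Polynomial.coeff_mul]
      refine E.sum_mem fun ij _ => ?_
      have : (algebraMap D[X] K[X] g).coeff ij.1 = algebraMap D K (g.coeff ij.1) :=
        Polynomial.coeff_map _ _
      rw [this, ← Algebra.smul_def]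
      exact E.smul_mem _ (hp _)
    · exact algebraMap.coe_smul g p (RatFunc K)

theorem algebraMap_mem_polyExtension {E : Submodule D K} {p : K[X]} :
    algebraMap K[X] (RatFunc K) p ∈ polyExtension E ↔ ∀ n, p.coeff n ∈ E := by
  constructor
  · rintro ⟨q, hq, h⟩
    rwa [← IsFractionRing.injective K[X] (RatFunc K) h]
  · exact fun h => ⟨p, h, rfl⟩

theorem polyExtension_mono {E F : Submodule D K} (h : E ≤ F) :
    polyExtension E ≤ polyExtension F := by
  rintro _ ⟨p, hp, rfl⟩
  exact ⟨p, fun n => h (hp n), rfl⟩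

/-- The content of a `D[X]`-submodule `A` of `K[X]`: the `D`-submodule of `K` generated by the
coefficients of all the polynomials in `A`. -/
def contentSubmodule (A : Submodule D[X] (RatFunc K)) : Submodule D K :=
  Submodule.span D {c | ∃ p : K[X], algebraMap K[X] (RatFunc K) p ∈ A ∧ ∃ n, p.coeff n = c}

theorem contentSubmodule_mono {A B : Submodule D[X] (RatFunc K)} (h : A ≤ B) :
    contentSubmodule A ≤ contentSubmodule B :=
  Submodule.span_mono (by
    rintro _ ⟨p, hp, n, rfl⟩
    exact ⟨p, h hp, n, rfl⟩)

theorem le_polyExtension_contentSubmodule {A : Submodule D[X] (RatFunc K)}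
    (hA : A ≤ polyExtension ⊤) : A ≤ polyExtension (contentSubmodule A) := by
  intro f hf
  obtain ⟨p, -, rfl⟩ := hA hf
  exact ⟨p, fun n => Submodule.subset_span ⟨p, hf, n, rfl⟩, rfl⟩

theorem contentSubmodule_le {A : Submodule D[X] (RatFunc K)} {E : Submodule D K}
    (hA : A ≤ polyExtension E) : contentSubmodule A ≤ E := by
  refine Submodule.span_le.2 ?_
  rintro _ ⟨p, hp, n, rfl⟩
  exact algebraMap_mem_polyExtension.1 (hA hp) n

namespace NonzeroSubmodule

/-- The extension `E[X]` of a nonzero submodule `E`. -/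
def poly (E : NonzeroSubmodule D K) : NonzeroSubmodule D[X] (RatFunc K) :=
  ⟨polyExtension E.1, by
    obtain ⟨x, hx, hx0⟩ := Submodule.exists_mem_ne_zero_of_ne_bot E.2
    refine (Submodule.ne_bot_iff _).2
      ⟨algebraMap K[X] (RatFunc K) (C x), ⟨C x, fun n => ?_, rfl⟩, ?_⟩
    · rw [coeff_C]
      split_ifs
      · exact hx
      · exact E.1.zero_mem
    · simpa using hx0⟩

/-- The content of a nonzero submodule `A` that is contained in `K[X]`. -/
def content (A : NonzeroSubmodule D[X] (RatFunc K)) (hA : A.1 ≤ polyExtension ⊤) :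
    NonzeroSubmodule D K :=
  ⟨contentSubmodule A.1, fun h => A.2 (by
    rw [eq_bot_iff]
    intro f hf
    obtain ⟨p, hp, rfl⟩ := le_polyExtension_contentSubmodule hA hf
    rw [h] at hp
    have : p = 0 := Polynomial.ext fun n => by simpa using hp n
    simp [this])⟩

end NonzeroSubmodule

namespace SemistarOperation

/-- The submodule `A^▲` of `K(X)`: the intersection of the `z⁻¹ (c(zA))^S[X]`, where `z` runs over
the nonzero elements of `K(X)` with `z A ⊆ K[X]` and `c` is the content. If there is no such `z`,
this is the empty intersection `K(X)`. -/
def maxExtSubmodule (S : SemistarOperation D K) (A : NonzeroSubmodule D[X] (RatFunc K)) :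
    Submodule D[X] (RatFunc K) :=
  ⨅ (z : RatFunc K) (hz : z ≠ 0) (hA : (A.dilate z hz).1 ≤ polyExtension ⊤),
    z⁻¹ • (S ((A.dilate z hz).content hA)).poly.1

theorem mem_maxExtSubmodule {S : SemistarOperation D K} {A : NonzeroSubmodule D[X] (RatFunc K)}
    {f : RatFunc K} : f ∈ S.maxExtSubmodule A ↔
      ∀ (z : RatFunc K) (hz : z ≠ 0) (hA : (A.dilate z hz).1 ≤ polyExtension ⊤),
        z * f ∈ polyExtension (S ((A.dilate z hz).content hA)).1 := by
  simp only [maxExtSubmodule, Submodule.mem_iInf]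
  refine forall_congr' fun z => forall_congr' fun hz => forall_congr' fun hA => ?_
  have := NonzeroSubmodule.mem_dilate (x := z⁻¹) (hx := inv_ne_zero hz)
    (E := (S ((A.dilate z hz).content hA)).poly) (y := f)
  rw [inv_inv] at this
  exact this

theorem le_maxExtSubmodule (S : SemistarOperation D K) (A : NonzeroSubmodule D[X] (RatFunc K)) :
    A.1 ≤ S.maxExtSubmodule A := by
  intro f hf
  rw [mem_maxExtSubmodule]
  intro z hz hA
  refine polyExtension_mono (S.le_map _) (le_polyExtension_contentSubmodule hA ?_)
  exact ⟨f, hf, rfl⟩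

/-- The semistar operation `▲^S` of `D[X]`, sending `A` to `A^▲`. -/
def maxExt (S : SemistarOperation D K) : SemistarOperation D[X] (RatFunc K) where
  toFun A := ⟨S.maxExtSubmodule A, fun h => A.2 (le_bot_iff.1 ((S.le_maxExtSubmodule A).trans h.le))⟩
  map_dilate x hx A := by
    have hdil : ∀ (z y : RatFunc K) (hz : z ≠ 0) (hy : y ≠ 0)
        (A : NonzeroSubmodule D[X] (RatFunc K)),
        (A.dilate y hy).dilate z hz = A.dilate (z * y) (mul_ne_zero hz hy) := by
      intro z y hz hy A
      refine Subtype.ext ?_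
      change z • (y • A.1) = (z * y) • A.1
      rw [smul_smul]
    ext f
    rw [NonzeroSubmodule.mem_dilate]
    change f ∈ S.maxExtSubmodule _ ↔ x⁻¹ * f ∈ S.maxExtSubmodule _
    rw [mem_maxExtSubmodule, mem_maxExtSubmodule]
    constructor
    · intro h z hz hA
      have hz' : z * x⁻¹ ≠ 0 := mul_ne_zero hz (inv_ne_zero hx)
      have e : (A.dilate x hx).dilate (z * x⁻¹) hz' = A.dilate z hz := by
        rw [hdil]
        congr 1
        field_simp
      have := h (z * x⁻¹) hz' (by rwa [e])
      simp only [e] at this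
      rwa [mul_assoc] at this
    · intro h z hz hA
      have e := hdil z x hz hx A
      have := h (z * x) (mul_ne_zero hz hx) (by rwa [← e])
      simp only [← e] at this
      rwa [mul_assoc, mul_inv_cancel_left₀ hx] at this
  mono A B h := by
    intro f hf
    change f ∈ S.maxExtSubmodule _ at hf
    change f ∈ S.maxExtSubmodule _
    rw [mem_maxExtSubmodule] at hf ⊢
    intro z hz hB
    have hAB : (A.dilate z hz).1 ≤ (B.dilate z hz).1 := Submodule.map_mono (Subtype.coe_le_coe.2 h)
    exact polyExtension_mono (S.mono _ _ (contentSubmodule_mono hAB)) (hf z hz (hAB.trans hB))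
  le_map A := S.le_maxExtSubmodule A
  idem A := by
    apply le_antisymm
    · intro f hf
      change f ∈ S.maxExtSubmodule _ at hf
      change f ∈ S.maxExtSubmodule _
      rw [mem_maxExtSubmodule] at hf ⊢
      intro z hz hA
      have hle : z • S.maxExtSubmodule A ≤
          polyExtension (S ((A.dilate z hz).content hA)).1 := by
        rintro _ ⟨g, hg, rfl⟩
        exact mem_maxExtSubmodule.1 hg z hz hA
      have := hf z hz (hle.trans (polyExtension_mono le_top))
      refine polyExtension_mono ?_ this
      have h2 := S.idem ((A.dilate z hz).content hA)
      refine le_trans (S.mono _ _ ?_) (le_of_eq (congrArg Subtype.val h2))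
      exact contentSubmodule_le hle
    · exact S.le_maxExtSubmodule _

/-- `T` is a strict extension of `S` to `D[X]`: `(E[X])^T = E^S[X]` for all `E`. -/
def IsStrictExtension (T : SemistarOperation D[X] (RatFunc K)) (S : SemistarOperation D K) :
    Prop :=
  ∀ E : NonzeroSubmodule D K, T E.poly = (S E).poly

end SemistarOperation

end PolynomialRing

end

/-! Write `c` for the content. Finite-type half: multiples of finitely generated `D[X]`-modules have
finitely generated contents whenever they lie in `K[X]`, so `▲^S` and `▲^{S_f}` agree on finitely
generated modules and have the same finite-type operation. Since `zA ⊆ c(zA)[X]`, every strict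
extension of `S` is `≤ ▲^S`; a finite-type one is then below the finite-type part, because it is
determined on finitely generated modules. Stable half: call a nonzero ideal `J` dense if `1 ∈ J^S`.
By Zorn, `x ∈ E^{S̃}` iff `Jx ⊆ E` for some finitely generated dense `J` (`mem_stableFinType`), so
stable finite-type operations are compared through their finitely generated dense ideals. The main
point is that such an ideal `J` for `▲^S` is also dense for `▲^{S̃}`
(`IsDense.maxExt_stableFinType`). Some `f ∈ J` has the content of all of `J`, and this content is
`S`-dense. If `zJ ⊆ K[X]`, then `z` is a polynomial. A weak Dedekind–Mertens lemma gives `c(f)^N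
c(z) ⊆ c(zJ)`; powers of dense ideals are dense, so the coefficients of `z` lie in `c(zJ)^{S̃}`. -/

namespace SemistarOperation

/-! ### Operations of finite type -/

section Dense

variable {D K : Type*} [CommRing D] [Field K] [Algebra D K]

theorem mem_finType {S : SemistarOperation D K} {E : NonzeroSubmodule D K} {x : K} :
    x ∈ (S.finType E).1 ↔ ∃ F : NonzeroSubmodule D K, F.1.FG ∧ F ≤ E ∧ x ∈ (S F).1 := Iff.rfl

theorem finType_apply_of_fg (S : SemistarOperation D K) {F : NonzeroSubmodule D K}
    (hF : F.1.FG) : S.finType F = S F := by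
  refine le_antisymm ?_ fun x hx => ⟨F, hF, le_rfl, hx⟩
  rintro x ⟨G, -, hGF, hx⟩
  exact S.mono _ _ hGF hx

theorem finType_le (S : SemistarOperation D K) : S.finType ≤ S := by
  rintro E x ⟨F, -, hFE, hx⟩
  exact S.mono _ _ hFE hx

theorem finType_congr {S T : SemistarOperation D K}
    (h : ∀ F : NonzeroSubmodule D K, F.1.FG → S F = T F) : S.finType = T.finType := by
  ext E x
  rw [mem_finType, mem_finType]
  exact exists_congr fun F => and_congr_right fun hF => by rw [h F hF]

theorem finType_finType (S : SemistarOperation D K) : S.finType.finType = S.finType :=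
  finType_congr fun _ hF => S.finType_apply_of_fg hF

theorem isFiniteType_finType (S : SemistarOperation D K) : S.finType.IsFiniteType :=
  S.finType_finType.symm

/-- Values on finitely generated modules determine `T`, so comparing there suffices. -/
theorem IsFiniteType.le_finType {S T : SemistarOperation D K} (hT : T.IsFiniteType)
    (h : ∀ F : NonzeroSubmodule D K, F.1.FG → T F ≤ S F) : T ≤ S.finType := by
  intro E x hx
  rw [hT] at hx
  obtain ⟨F, hF, hFE, hx⟩ := hx
  exact ⟨F, hF, hFE, h F hF hx⟩

/-! ### Dense ideals -/

/-- The ideal of the `d` in `D` with `d x ∈ E`. -/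
def colonIdeal (E : Submodule D K) (x : K) : Ideal D :=
  E.comap (LinearMap.toSpanSingleton D K x)

theorem mem_colonIdeal {E : Submodule D K} {x : K} {d : D} :
    d ∈ colonIdeal E x ↔ d • x ∈ E := Iff.rfl

variable [IsFractionRing D K]

theorem fg_ofIdeal {I : Ideal D} (hI : I ≠ ⊥) (hfg : I.FG) :
    (NonzeroSubmodule.ofIdeal (K := K) I hI).1.FG :=
  Submodule.FG.map _ hfg

theorem ofIdeal_mono {I J : Ideal D} (hI : I ≠ ⊥) (hJ : J ≠ ⊥) (h : I ≤ J) :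
    (NonzeroSubmodule.ofIdeal I hI : NonzeroSubmodule D K) ≤ NonzeroSubmodule.ofIdeal J hJ :=
  Submodule.map_mono h

/-- A nonzero ideal `J` of `D` is `S`-dense if `1` belongs to `J^S`. -/
def IsDense (S : SemistarOperation D K) (J : Ideal D) : Prop :=
  ∃ hJ : J ≠ ⊥, (1 : K) ∈ (S (NonzeroSubmodule.ofIdeal J hJ)).1

theorem IsDense.mono {S T : SemistarOperation D K} (hST : S ≤ T) {I J : Ideal D} (h : I ≤ J)
    (hI : S.IsDense I) : T.IsDense J := by
  obtain ⟨hI0, h1⟩ := hI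
  have hJ : J ≠ ⊥ := fun h0 => hI0 (le_bot_iff.1 (h0 ▸ h))
  exact ⟨hJ, T.mono _ _ (ofIdeal_mono hI0 hJ h) (hST _ h1)⟩

/-- From `xJ ⊆ E` follows `x = x·1 ∈ xJ^S = (xJ)^S ⊆ E^S`. -/
theorem IsDense.mem_of_smul_mem {S : SemistarOperation D K} {J : Ideal D} (hJ : S.IsDense J)
    {E : NonzeroSubmodule D K} {x : K} (hx : ∀ d ∈ J, d • x ∈ E.1) : x ∈ (S E).1 := by
  obtain ⟨hJ0, h1⟩ := hJ
  by_cases hx0 : x = 0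
  · rw [hx0]
    exact Submodule.zero_mem _
  have hle : (NonzeroSubmodule.ofIdeal (K := K) J hJ0).dilate x hx0 ≤ E := by
    rintro _ ⟨_, ⟨d, hd, rfl⟩, rfl⟩
    have := hx d hd
    rw [Algebra.smul_def, mul_comm] at this
    exact this
  refine S.mono _ _ hle ?_
  rw [S.map_dilate, NonzeroSubmodule.mem_dilate, inv_mul_cancel₀ hx0]
  exact h1

theorem isDense_top [Nontrivial D] (S : SemistarOperation D K) : S.IsDense (⊤ : Ideal D) :=
  ⟨top_ne_bot, S.le_map _ ⟨1, trivial, by simp⟩⟩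

theorem IsDense.mul {S : SemistarOperation D K} {I J : Ideal D} (hI : S.IsDense I)
    (hJ : S.IsDense J) : S.IsDense (I * J) := by
  have : IsDomain D := (IsFractionRing.injective D K).isDomain
  have h0 : I * J ≠ ⊥ := by
    rw [Ne, Ideal.mul_eq_bot]
    exact fun h => h.elim hI.1 hJ.1
  refine ⟨h0, ?_⟩
  -- Idempotence allows density to be used twice: `b·a ∈ IJ` for all `b ∈ J` gives `a ∈ (IJ)^S`, and
  -- then `1 ∈ ((IJ)^S)^S`.
  rw [← S.idem]
  refine hI.mem_of_smul_mem fun a ha => hJ.mem_of_smul_mem fun b hb => ?_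
  exact ⟨a * b, Ideal.mul_mem_mul ha hb, by simp [Algebra.smul_def, mul_comm]⟩

theorem IsDense.pow {S : SemistarOperation D K} {I : Ideal D} (hI : S.IsDense I) (n : ℕ) :
    S.IsDense (I ^ n) := by
  have : IsDomain D := (IsFractionRing.injective D K).isDomain
  induction n with
  | zero =>
    rw [pow_zero, Ideal.one_eq_top]
    exact S.isDense_top
  | succ n ih =>
    rw [pow_succ]
    exact ih.mul hI

theorem exists_ideal_of_fg_le {F : NonzeroSubmodule D K} (hF : F.1.FG) {I : Ideal D}
    {hI : I ≠ ⊥} (hFI : F ≤ NonzeroSubmodule.ofIdeal I hI) :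
    ∃ (J : Ideal D) (hJ : J ≠ ⊥), J.FG ∧ J ≤ I ∧ F = NonzeroSubmodule.ofIdeal J hJ := by
  have hinj : Function.Injective (Algebra.linearMap D K) := IsFractionRing.injective D K
  have hmap : Submodule.map (Algebra.linearMap D K)
      (F.1.comap (Algebra.linearMap D K)) = F.1 := by
    rw [Submodule.map_comap_eq, inf_eq_right]
    intro x hx
    obtain ⟨d, -, rfl⟩ := hFI hx
    exact ⟨d, rfl⟩
  refine ⟨F.1.comap (Algebra.linearMap D K), ?_, ?_, ?_, Subtype.ext hmap.symm⟩
  · intro h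
    rw [h, Submodule.map_bot] at hmap
    exact F.2 hmap.symm
  · refine Submodule.fg_of_fg_map_injective _ hinj ?_
    rwa [hmap]
  · intro d hd
    obtain ⟨e, he, hed⟩ := hFI hd
    rwa [← hinj hed]

/-- The finitely generated submodule witnessing `1 ∈ I^{S_f}` lies in `I`, hence is itself an ideal
of `D`. -/
theorem isDense_finType_iff {S : SemistarOperation D K} {I : Ideal D} :
    S.finType.IsDense I ↔ ∃ J ≤ I, J.FG ∧ S.IsDense J := by
  constructor
  · rintro ⟨hI, F, hF, hFI, h1⟩
    obtain ⟨J, hJ, hfg, hJI, rfl⟩ := exists_ideal_of_fg_le hF hFI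
    exact ⟨J, hJI, hfg, hJ, h1⟩
  · rintro ⟨J, hJI, hfg, hJ, h1⟩
    exact IsDense.mono le_rfl hJI ⟨hJ, NonzeroSubmodule.ofIdeal J hJ, fg_ofIdeal hJ hfg, le_rfl, h1⟩

/-! ### Quasi-maximal ideals and the associated stable operation -/

theorem IsQuasiIdeal.not_isDense {S : SemistarOperation D K} {I : Ideal D}
    (hI : S.IsQuasiIdeal I) (htop : I ≠ ⊤) : ¬ S.IsDense I := by
  rintro ⟨h0, h1⟩
  obtain ⟨_, hI⟩ := hI
  refine htop ((Ideal.eq_top_iff_one _).2 ?_)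
  rw [← hI]
  simpa using h1

/-- An ideal that is not dense for `S.finType` is contained in a quasi-maximal ideal. -/
theorem exists_isQuasiMaximal_ge {S : SemistarOperation D K} {I : Ideal D} (hI0 : I ≠ ⊥)
    (hI : ¬ S.finType.IsDense I) : ∃ P, S.finType.IsQuasiMaximal P ∧ I ≤ P := by
  have : IsDomain D := (IsFractionRing.injective D K).isDomain
  -- Density for `S_f` is witnessed by a finitely generated, hence compact, ideal, so the union of a
  -- chain of non-dense ideals is non-dense.
  obtain ⟨P, hIP, hP⟩ := zorn_le_nonempty₀ {J : Ideal D | ¬ S.finType.IsDense J} (by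
    intro c hc hchain J hJ
    refine ⟨sSup c, fun hd => ?_, fun _ => le_sSup⟩
    obtain ⟨L, hL, hfg, hLd⟩ := isDense_finType_iff.1 hd
    obtain ⟨M, hM, hLM⟩ := (CompleteLattice.isCompactElement_iff_le_of_directed_sSup_le _ _).1
      ((Submodule.fg_iff_compact L).1 hfg) c ⟨J, hJ⟩ hchain.directedOn hL
    exact hc hM (isDense_finType_iff.2 ⟨L, hLM, hfg, hLd⟩)) I hI
  have hP0 : P ≠ ⊥ := fun h => hI0 (le_bot_iff.1 (h ▸ hIP))
  have hle : P ≤ (S.finType (NonzeroSubmodule.ofIdeal P hP0)).1.comap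
      (Algebra.linearMap D K) := fun d hd => S.finType.le_map _ ⟨d, hd, rfl⟩
  refine ⟨P, ⟨⟨⟨hP0, le_antisymm (hP.2 ?_ hle) hle⟩, ?_⟩, ?_⟩, hIP⟩
  -- The contraction of `P^{S_f}` to `D` is not dense either, by idempotence; maximality makes it
  -- equal to `P`.
  · rintro ⟨h0, h1⟩
    refine hP.1 ⟨hP0, ?_⟩
    rw [← S.finType.idem]
    refine S.finType.mono _ _ ?_ h1
    rintro _ ⟨d, hd, rfl⟩
    exact hd
  · rintro rfl
    exact hP.1 S.finType.isDense_top
  · rintro Q ⟨hQ, hQt⟩ hPQ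
    exact hP.2 (hQ.not_isDense hQt) hPQ

theorem colonIdeal_ne_bot (E : NonzeroSubmodule D K) (x : K) : colonIdeal E.1 x ≠ ⊥ := by
  have : IsDomain D := (IsFractionRing.injective D K).isDomain
  by_cases hx : x = 0
  · have : colonIdeal E.1 x = ⊤ :=
      (Ideal.eq_top_iff_one _).2 (by simp [mem_colonIdeal, hx])
    rw [this]
    exact top_ne_bot
  let X : NonzeroSubmodule D K := ⟨Submodule.span D {x}, by simpa using hx⟩
  obtain ⟨y, ⟨hyE, hyX⟩, hy0⟩ :=
    Submodule.exists_mem_ne_zero_of_ne_bot (NonzeroSubmodule.inf_ne_bot E X)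
  obtain ⟨d, rfl⟩ := Submodule.mem_span_singleton.1 hyX
  refine (Submodule.ne_bot_iff _).2 ⟨d, hyE, ?_⟩
  rintro rfl
  exact hy0 (zero_smul _ _)

/-- The colon ideal of `E` at `x` is either dense or inside some quasi-maximal `P`. In the latter
case `x ∉ E D_P`; conversely a dense ideal lies in no quasi-maximal `P`, so it supplies a
denominator outside each. -/
theorem mem_stableFinType {S : SemistarOperation D K} {E : NonzeroSubmodule D K} {x : K} :
    x ∈ (S.stableFinType E).1 ↔ ∃ J : Ideal D, J.FG ∧ S.IsDense J ∧ ∀ d ∈ J, d • x ∈ E.1 := by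
  have hmem : x ∈ (S.stableFinType E).1 ↔ ∀ P : PrimeSpectrum D,
      S.finType.IsQuasiMaximal P.asIdeal → ∃ s : D, s ∉ P.asIdeal ∧ s • x ∈ E.1 := by
    change x ∈ ⨅ P ∈ {P : PrimeSpectrum D | S.finType.IsQuasiMaximal P.asIdeal}, _ ↔ _
    simp only [Submodule.mem_iInf]
    rfl
  rw [hmem]
  constructor
  · intro h
    by_contra hcon
    have hI : ¬ S.finType.IsDense (colonIdeal E.1 x) := fun hd => by
      obtain ⟨J, hJ, hfg, hJd⟩ := isDense_finType_iff.1 hd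
      exact hcon ⟨J, hfg, hJd, fun d hd => hJ hd⟩
    obtain ⟨P, hP, hle⟩ := exists_isQuasiMaximal_ge (colonIdeal_ne_bot E x) hI
    obtain ⟨s, hs, hsx⟩ := h ⟨P, hP.isPrime⟩ hP
    exact hs (hle hsx)
  · rintro ⟨J, hfg, hJ, hJx⟩ P hP
    by_contra! hcon
    refine hP.1.1.not_isDense hP.1.2 (isDense_finType_iff.2 ⟨J, fun d hd => ?_, hfg, hJ⟩)
    by_contra hdP
    exact hcon d hdP (hJx d hd)

theorem stableFinType_le (S : SemistarOperation D K) : S.stableFinType ≤ S := by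
  intro E x hx
  obtain ⟨J, -, hJ, hJx⟩ := mem_stableFinType.1 hx
  exact hJ.mem_of_smul_mem hJx

theorem stableFinType_mono_of_isDense {S T : SemistarOperation D K}
    (h : ∀ J : Ideal D, J.FG → S.IsDense J → T.IsDense J) :
    S.stableFinType ≤ T.stableFinType := by
  intro E x hx
  obtain ⟨J, hfg, hJ, hJx⟩ := mem_stableFinType.1 hx
  exact mem_stableFinType.2 ⟨J, hfg, h J hfg hJ, hJx⟩

theorem isStable_stableFinType (S : SemistarOperation D K) : S.stableFinType.IsStable := by
  intro E F
  have h1 : E.inter F ≤ E := fun _ h => h.1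
  have h2 : E.inter F ≤ F := fun _ h => h.2
  refine le_antisymm (fun x hx => ⟨S.stableFinType.mono _ _ h1 hx,
    S.stableFinType.mono _ _ h2 hx⟩) ?_
  · intro x hx
    obtain ⟨hE : x ∈ (S.stableFinType E).1, hF : x ∈ (S.stableFinType F).1⟩ := hx
    obtain ⟨I, hIfg, hI, hIx⟩ := mem_stableFinType.1 hE
    obtain ⟨J, hJfg, hJ, hJx⟩ := mem_stableFinType.1 hF
    have hIJ : (I * J).FG := Submodule.FG.mul hIfg hJfg
    refine mem_stableFinType.2 ⟨I * J, hIJ, hI.mul hJ, fun d hd => ?_⟩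
    exact ⟨hIx d (Ideal.mul_le_left hd), hJx d (Ideal.mul_le_right hd)⟩

theorem isFiniteType_stableFinType (S : SemistarOperation D K) :
    S.stableFinType.IsFiniteType := by
  refine le_antisymm (fun E x hx => ?_) (finType_le _)
  obtain ⟨J, hfg, hJ, hJx⟩ := mem_stableFinType.1 hx
  by_cases hx0 : x = 0
  · rw [hx0]
    exact Submodule.zero_mem _
  -- The finitely generated module `xJ ⊆ E` already has `x` in its closure.
  refine ⟨(NonzeroSubmodule.ofIdeal J hJ.1).dilate x hx0, (fg_ofIdeal hJ.1 hfg).map _, ?_,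
    mem_stableFinType.2 ⟨J, hfg, hJ, fun d hd => ?_⟩⟩
  · rintro _ ⟨_, ⟨d, hd, rfl⟩, rfl⟩
    have := hJx d hd
    rw [Algebra.smul_def, mul_comm] at this
    exact this
  · exact ⟨algebraMap D K d, ⟨d, hd, rfl⟩, by simp [Algebra.smul_def, mul_comm]⟩

/-- A stable semistar operation of finite type is its own associated stable operation of finite
type. -/
theorem IsStable.le_stableFinType {T : SemistarOperation D K} (hT : T.IsStable)
    (hfin : T.IsFiniteType) : T ≤ T.stableFinType := by
  have : IsDomain D := (IsFractionRing.injective D K).isDomain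
  intro E x hx
  by_cases hx0 : x = 0
  · rw [hx0]
    exact Submodule.zero_mem _
  let U : NonzeroSubmodule D K := NonzeroSubmodule.ofIdeal ⊤ top_ne_bot
  have h1 : (1 : K) ∈ U.1 := ⟨1, trivial, by simp⟩
  have hd : T.finType.IsDense (colonIdeal E.1 x) := by
    refine ⟨colonIdeal_ne_bot E x, ?_⟩
    -- The colon ideal is `D ∩ x⁻¹E`; stability splits its closure, and `1` lies in both factors.
    have hcolon : U.inter (E.dilate x⁻¹ (inv_ne_zero hx0)) ≤
        NonzeroSubmodule.ofIdeal (colonIdeal E.1 x) (colonIdeal_ne_bot E x) := by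
      rintro _ ⟨⟨d, -, rfl⟩, hy⟩
      refine ⟨d, ?_, rfl⟩
      have hy := NonzeroSubmodule.mem_dilate.1 hy
      rwa [inv_inv, mul_comm, Algebra.linearMap_apply, ← Algebra.smul_def] at hy
    rw [← hfin]
    refine T.mono _ _ hcolon ?_
    rw [hT]
    refine ⟨T.le_map _ h1, ?_⟩
    rw [T.map_dilate]
    exact NonzeroSubmodule.mem_dilate.2 (by rwa [inv_inv, mul_one])
  obtain ⟨J, hJ, hfg, hJd⟩ := isDense_finType_iff.1 hd
  exact mem_stableFinType.2 ⟨J, hfg, hJd, fun d hd => hJ hd⟩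

end Dense

end SemistarOperation

/-! ### A weak Dedekind–Mertens lemma -/

theorem Ideal.sup_pow_le_pow_sup {R : Type*} [CommSemiring R] (I J : Ideal R) (n : ℕ) :
    (I ⊔ J) ^ n ≤ I ^ n ⊔ J := by
  induction n with
  | zero => simp
  | succ n ih =>
    rw [pow_succ, pow_succ]
    refine (Ideal.mul_mono_left ih).trans ?_
    rw [Ideal.sup_mul, Ideal.mul_sup]
    exact sup_le (sup_le le_sup_left (Ideal.mul_le_right.trans le_sup_right))
      (Ideal.mul_le_left.trans le_sup_right)

/-- A weak form of the Dedekind–Mertens lemma: if all coefficients of `f z` lie in `Q`, then a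
power of the content ideal of `f` multiplies all coefficients of `z` into `Q`. -/
theorem exists_contentIdeal_pow_smul_coeff_mem {D K : Type*} [CommRing D] [CommRing K]
    [Algebra D K] (f : D[X]) (z : K[X]) (Q : Submodule D K)
    (h : ∀ n, (f.map (algebraMap D K) * z).coeff n ∈ Q) :
    ∃ N : ℕ, ∀ r ∈ f.contentIdeal ^ N, ∀ n, r • z.coeff n ∈ Q := by
  induction hk : f.support.card generalizing f z Q with
  | zero =>
    have hf : f = 0 := by simpa using hk
    subst hf
    -- The exponent must be positive: the zeroth power of the zero content ideal is the unit ideal.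
    refine ⟨1, fun r hr n => ?_⟩
    have : r = 0 := by simpa using hr
    simp [this]
  | succ k ihk =>
    -- The outer induction is on the number of terms of `f`, the inner one on the degree of `z`.
    induction hm : z.natDegree using Nat.strong_induction_on generalizing z with
    | _ m ihm =>
    set a := f.leadingCoeff with ha
    have hfa : f.eraseLead.map (algebraMap D K) =
        f.map (algebraMap D K) - C (algebraMap D K a) * X ^ f.natDegree := by
      rw [eq_sub_iff_add_eq]
      have := congrArg (Polynomial.map (algebraMap D K)) f.eraseLead_add_C_mul_X_pow
      rwa [Polynomial.map_add, Polynomial.map_mul, Polynomial.map_pow, map_X, map_C] at this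
    have htop : a • z.coeff m ∈ Q := by
      have := h (f.natDegree + m)
      rwa [coeff_mul_add_eq_of_natDegree_le natDegree_map_le hm.le, coeff_map,
        coeff_natDegree, ← Algebra.smul_def] at this
    obtain ⟨N, hN⟩ : ∃ N : ℕ, ∀ r ∈ f.contentIdeal ^ N, ∀ n, r • a • z.coeff n ∈ Q := by
      -- Constants are separate since erasing the leading term of a constant does not lower
      -- `natDegree`.
      rcases Nat.eq_zero_or_pos m with rfl | hpos
      · refine ⟨0, fun r _ n => Q.smul_mem _ ?_⟩
        rcases Nat.eq_zero_or_pos n with rfl | hn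
        · exact htop
        · simp [coeff_eq_zero_of_natDegree_lt (hm.trans_lt hn)]
      · have hz : z.eraseLead = z - C (z.coeff m) * X ^ m := by
          rw [eq_sub_iff_add_eq, ← hm]
          exact z.eraseLead_add_C_mul_X_pow
        have hdeg : (C (algebraMap D K a) * z.eraseLead).natDegree < m :=
          (natDegree_C_mul_le _ _).trans_lt ((eraseLead_natDegree_le z).trans_lt (by omega))
        -- The inner induction applies to `a` times `z` without its leading term: its product with
        -- `f` is `a(fz) - (a z_m) f X^m`, and `a z_m ∈ Q`.
        obtain ⟨N, hN⟩ : ∃ N : ℕ, ∀ r ∈ f.contentIdeal ^ N, ∀ n,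
            r • (C (algebraMap D K a) * z.eraseLead).coeff n ∈ Q := by
          refine ihm _ hdeg _ (fun n => ?_) rfl
          have : f.map (algebraMap D K) * (C (algebraMap D K a) * z.eraseLead) =
              C (algebraMap D K a) * (f.map (algebraMap D K) * z) -
                C (algebraMap D K a * z.coeff m) * f.map (algebraMap D K) * X ^ m := by
            rw [hz, C_mul]
            ring
          rw [this, coeff_sub, coeff_C_mul, ← Algebra.smul_def, coeff_mul_X_pow']
          refine Q.sub_mem (Q.smul_mem _ (h n)) ?_
          split_ifs
          · rw [coeff_C_mul, coeff_map, mul_comm, ← Algebra.smul_def, ← Algebra.smul_def]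
            exact Q.smul_mem _ htop
          · exact Q.zero_mem
        refine ⟨N, fun r hr n => ?_⟩
        by_cases hn : n = m
        · rw [hn]
          exact Q.smul_mem _ htop
        · have := hN r hr n
          rwa [coeff_C_mul, eraseLead_coeff_of_ne _ (hm ▸ hn), ← Algebra.smul_def] at this
    -- `Q'` is the quotient `(Q : c(f)^N)`. It contains the coefficients of `a z`, hence also those
    -- of `z` times `f` without its leading term, so the outer induction applies.
    let Q' : Submodule D K :=
      { carrier := {x | ∀ r ∈ f.contentIdeal ^ N, r • x ∈ Q}
        zero_mem' := fun r _ => by simp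
        add_mem' := fun hx hy r hr => by
          rw [smul_add]
          exact Q.add_mem (hx r hr) (hy r hr)
        smul_mem' := fun d x hx r hr => by
          rw [smul_comm]
          exact Q.smul_mem _ (hx r hr) }
    obtain ⟨M, hM⟩ := ihk f.eraseLead z Q' (fun n r hr => by
      rw [hfa, sub_mul, mul_assoc, coeff_sub, coeff_C_mul, coeff_X_pow_mul', smul_sub]
      refine Q.sub_mem (Q.smul_mem _ (h n)) ?_
      split_ifs
      · rw [← Algebra.smul_def]
        exact hN r hr _
      · simp) (by
        have := card_support_eraseLead_add_one (f := f) (by rintro rfl; simp at hk)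
        omega)
    refine ⟨N + M, fun r hr n => ?_⟩
    have hle : f.contentIdeal ≤ f.eraseLead.contentIdeal ⊔ Ideal.span {a} := by
      refine Ideal.span_le.2 fun c hc => ?_
      obtain ⟨i, -, rfl⟩ := mem_coeffs_iff.1 hc
      by_cases hi : i = f.natDegree
      · rw [hi]
        exact Ideal.mem_sup_right (Ideal.mem_span_singleton_self _)
      · rw [← eraseLead_coeff_of_ne i hi]
        exact Ideal.mem_sup_left (coeff_mem_contentIdeal _ _)
    rw [pow_add] at hr
    refine (Ideal.mul_le (K := Q.comap (LinearMap.toSpanSingleton D K (z.coeff n)))).2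
      (fun s hs t ht => ?_) hr
    -- With `f'` for `f` without its leading term, `c(f)^M ⊆ c(f')^M + (a)`: the first summand is
    -- handled by `hM`, the second by `hN`.
    obtain ⟨u, hu, v, hv, rfl⟩ := Submodule.mem_sup.1
      (Ideal.sup_pow_le_pow_sup _ _ _ (Ideal.pow_right_mono hle M ht))
    obtain ⟨w, rfl⟩ := Ideal.mem_span_singleton'.1 hv
    change (s * (u + w * a)) • z.coeff n ∈ Q
    rw [mul_add, add_smul, mul_smul, mul_left_comm, mul_smul, mul_smul]
    exact Q.add_mem (hM u hu n s hs) (Q.smul_mem _ (hN s hs n))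

/-! ### Extended modules and contents -/

section PolynomialModules

variable {D K : Type*} [CommRing D] [Field K] [Algebra D K]

theorem algebraMap_polynomial_ratFunc (p : D[X]) : algebraMap D[X] (RatFunc K) p =
    algebraMap K[X] (RatFunc K) (p.map (algebraMap D K)) := by
  rw [IsScalarTower.algebraMap_apply D[X] K[X] (RatFunc K)]
  rfl

theorem polynomial_smul_algebraMap (g : D[X]) (p : K[X]) :
    g • algebraMap K[X] (RatFunc K) p =
      algebraMap K[X] (RatFunc K) (g.map (algebraMap D K) * p) := by
  rw [Algebra.smul_def, algebraMap_polynomial_ratFunc, map_mul]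

theorem polyExtension_le {E : Submodule D K} {A : Submodule D[X] (RatFunc K)}
    (h : ∀ c ∈ E, algebraMap K[X] (RatFunc K) (C c) ∈ A) : polyExtension E ≤ A := by
  rintro _ ⟨p, hp, rfl⟩
  rw [p.as_sum_range_C_mul_X_pow, map_sum]
  refine A.sum_mem fun n _ => ?_
  have : (X ^ n : D[X]) • algebraMap K[X] (RatFunc K) (C (p.coeff n)) =
      algebraMap K[X] (RatFunc K) (C (p.coeff n) * X ^ n) := by
    rw [polynomial_smul_algebraMap, Polynomial.map_pow, map_X, mul_comm]
  rw [← this]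
  exact A.smul_mem _ (h _ (hp n))

theorem C_mem_polyExtension {E : Submodule D K} {c : K} (hc : c ∈ E) :
    algebraMap K[X] (RatFunc K) (C c) ∈ polyExtension E := by
  rw [algebraMap_mem_polyExtension]
  intro n
  rw [coeff_C]
  split_ifs
  · exact hc
  · exact E.zero_mem

theorem mem_polyExtension_top {f : RatFunc K} :
    f ∈ polyExtension (⊤ : Submodule D K) ↔ ∃ p : K[X], algebraMap K[X] (RatFunc K) p = f :=
  ⟨fun ⟨p, _, h⟩ => ⟨p, h⟩, fun ⟨p, h⟩ => ⟨p, fun _ => trivial, h⟩⟩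

theorem coeff_mem_contentSubmodule {A : Submodule D[X] (RatFunc K)} {p : K[X]}
    (hp : algebraMap K[X] (RatFunc K) p ∈ A) (n : ℕ) : p.coeff n ∈ contentSubmodule A :=
  Submodule.subset_span ⟨p, hp, n, rfl⟩

theorem C_mem_span_image {s : Set K} {c : K} (hc : c ∈ Submodule.span D s) :
    algebraMap K[X] (RatFunc K) (C c) ∈
      Submodule.span D[X] ((fun c => algebraMap K[X] (RatFunc K) (C c)) '' s) := by
  induction hc using Submodule.span_induction with
  | mem x hx => exact Submodule.subset_span ⟨x, hx, rfl⟩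
  | zero => simp
  | add x y _ _ hx hy =>
    rw [C_add, map_add]
    exact Submodule.add_mem _ hx hy
  | smul d x _ hx =>
    have : algebraMap K[X] (RatFunc K) (C (d • x)) =
        (C d : D[X]) • algebraMap K[X] (RatFunc K) (C x) := by
      rw [polynomial_smul_algebraMap, map_C, Algebra.smul_def, C_mul]
    rw [this]
    exact Submodule.smul_mem _ _ hx

theorem fg_polyExtension {E : Submodule D K} (hE : E.FG) : (polyExtension E).FG := by
  classical
  obtain ⟨s, rfl⟩ := hE
  refine ⟨s.image fun c => algebraMap K[X] (RatFunc K) (C c), le_antisymm ?_ ?_⟩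
  · refine Submodule.span_le.2 ?_
    intro f hf
    obtain ⟨c, hc, rfl⟩ := Finset.mem_image.1 (Finset.mem_coe.1 hf)
    exact C_mem_polyExtension (Submodule.subset_span hc)
  · refine polyExtension_le fun c hc => ?_
    rw [Finset.coe_image]
    exact C_mem_span_image hc

/-- The coefficients of a finite generating set suffice, since multiplying by elements of `D[X]`
only forms `D`-combinations of them. -/
theorem fg_contentSubmodule {A : Submodule D[X] (RatFunc K)} (hA : A ≤ polyExtension ⊤)
    (hfg : A.FG) : (contentSubmodule A).FG := by
  classical
  obtain ⟨t, rfl⟩ := hfg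
  have ht : (t : Set (RatFunc K)) ⊆ algebraMap K[X] (RatFunc K) '' Set.univ := by
    intro f hf
    obtain ⟨p, hp⟩ := mem_polyExtension_top.1 (hA (Submodule.subset_span hf))
    exact ⟨p, trivial, hp⟩
  obtain ⟨u, -, rfl⟩ := Finset.subset_set_image_iff.1 ht
  refine ⟨u.biUnion fun p => p.coeffs, le_antisymm ?_ ?_⟩
  · refine Submodule.span_le.2 fun c hc => ?_
    obtain ⟨p, hp, hc⟩ := Finset.mem_biUnion.1 (Finset.mem_coe.1 hc)
    obtain ⟨n, -, rfl⟩ := mem_coeffs_iff.1 hc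
    exact coeff_mem_contentSubmodule
      (Submodule.subset_span (Finset.mem_coe.2 (Finset.mem_image_of_mem _ hp))) n
  · refine contentSubmodule_le (Submodule.span_le.2 fun f hf => ?_)
    obtain ⟨p, hp, rfl⟩ := Finset.mem_image.1 (Finset.mem_coe.1 hf)
    refine algebraMap_mem_polyExtension.2 fun n => ?_
    by_cases hn : p.coeff n = 0
    · rw [hn]
      exact Submodule.zero_mem _
    · exact Submodule.subset_span (Finset.mem_coe.2
        (Finset.mem_biUnion.2 ⟨p, hp, coeff_mem_coeffs hn⟩))

/-- A finitely generated ideal of `D[X]` contains a polynomial whose coefficients generate the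
content of the ideal. -/
theorem exists_mem_span_contentIdeal {R : Type*} [CommRing R] (s : Finset R[X]) :
    ∃ f ∈ Ideal.span (s : Set R[X]), ∀ g ∈ Ideal.span (s : Set R[X]), ∀ n,
      g.coeff n ∈ f.contentIdeal := by
  classical
  suffices h : ∃ f ∈ Ideal.span (s : Set R[X]), ∀ g ∈ s, ∀ n, g.coeff n ∈ f.contentIdeal by
    obtain ⟨f, hf, h⟩ := h
    refine ⟨f, hf, fun g hg n => ?_⟩
    have hle : Ideal.span (s : Set R[X]) ≤ f.contentIdeal.map C :=
      Ideal.span_le.2 fun g hg => Ideal.mem_map_C_iff.2 (h g hg)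
    exact Ideal.mem_map_C_iff.1 (hle hg) n
  induction s using Finset.induction_on with
  | empty => exact ⟨0, Submodule.zero_mem _, by simp⟩
  | insert g s _ ih =>
    obtain ⟨f, hf, hs⟩ := ih
    have hf' : f ∈ Ideal.span ((insert g s : Finset R[X]) : Set R[X]) :=
      Ideal.span_mono (by simp) hf
    have hg' : g ∈ Ideal.span ((insert g s : Finset R[X]) : Set R[X]) :=
      Ideal.subset_span (by simp)
    -- Shifting `g` beyond the degree of `f` keeps the coefficients apart, so the sum has those of
    -- both.
    have hfc : ∀ n, f.coeff n ∈ (f + g * X ^ (f.natDegree + 1)).contentIdeal := by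
      intro n
      by_cases hn : f.natDegree < n
      · rw [coeff_eq_zero_of_natDegree_lt hn]
        exact Submodule.zero_mem _
      · have := coeff_mem_contentIdeal (f + g * X ^ (f.natDegree + 1)) n
        rwa [coeff_add, coeff_mul_X_pow', if_neg (by omega), add_zero] at this
    refine ⟨f + g * X ^ (f.natDegree + 1), add_mem hf' (Ideal.mul_mem_right _ _ hg'), ?_⟩
    intro q hq n
    rcases Finset.mem_insert.1 hq with rfl | hq
    · have := coeff_mem_contentIdeal (f + q * X ^ (f.natDegree + 1)) (n + (f.natDegree + 1))
      rwa [coeff_add, coeff_mul_X_pow, coeff_eq_zero_of_natDegree_lt (by omega), zero_add] at this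
    · have hle : f.contentIdeal ≤ (f + g * X ^ (f.natDegree + 1)).contentIdeal := by
        refine Ideal.span_le.2 fun c hc => ?_
        obtain ⟨i, -, rfl⟩ := mem_coeffs_iff.1 hc
        exact hfc i
      exact hle (hs q hq n)

end PolynomialModules

/-! ### The operation `▲^S` and its finite-type part -/

namespace SemistarOperation

variable {D K : Type*} [CommRing D] [Field K] [Algebra D K]

theorem mem_maxExt {S : SemistarOperation D K} {A : NonzeroSubmodule D[X] (RatFunc K)}
    {f : RatFunc K} : f ∈ (S.maxExt A).1 ↔
      ∀ (z : RatFunc K) (hz : z ≠ 0) (hA : (A.dilate z hz).1 ≤ polyExtension ⊤),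
        z * f ∈ polyExtension (S ((A.dilate z hz).content hA)).1 :=
  mem_maxExtSubmodule

theorem mem_polyExtension_of_mem_maxExt {S : SemistarOperation D K}
    {A : NonzeroSubmodule D[X] (RatFunc K)} (hA : A.1 ≤ polyExtension ⊤) {f : RatFunc K}
    (hf : f ∈ (S.maxExt A).1) : f ∈ polyExtension (S (A.content hA)).1 := by
  have e : A.dilate 1 one_ne_zero = A := Subtype.ext (one_smul _ _)
  have := mem_maxExt.1 hf 1 one_ne_zero (by rwa [e])
  simpa only [e, one_mul] using this

theorem maxExt_mono {S T : SemistarOperation D K} (h : S ≤ T) : S.maxExt ≤ T.maxExt := by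
  intro A f hf
  have hf := mem_maxExt.1 hf
  exact mem_maxExt.2 fun z hz hA => polyExtension_mono (h _) (hf z hz hA)

theorem maxExt_finType_apply (S : SemistarOperation D K)
    {F : NonzeroSubmodule D[X] (RatFunc K)} (hF : F.1.FG) :
    S.finType.maxExt F = S.maxExt F := by
  ext f
  refine mem_maxExt.trans (Iff.trans ?_ mem_maxExt.symm)
  refine forall_congr' fun z => forall_congr' fun hz => forall_congr' fun hA => ?_
  rw [finType_apply_of_fg]
  exact fg_contentSubmodule hA (hF.map _)

theorem C_mem_maxExt_poly {S : SemistarOperation D K} {E : NonzeroSubmodule D K} {c : K}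
    (hc : c ∈ (S E).1) : algebraMap K[X] (RatFunc K) (C c) ∈ (S.maxExt E.poly).1 := by
  refine mem_maxExt.2 fun z hz hA => ?_
  have hE : ∀ e ∈ E.1, z * algebraMap K[X] (RatFunc K) (C e) ∈ (E.poly.dilate z hz).1 :=
    fun e he => ⟨_, C_mem_polyExtension he, rfl⟩
  -- A nonzero `e ∈ E` is a unit of `K[X]`, so `ze ∈ K[X]` forces `z ∈ K[X]`.
  obtain ⟨p, rfl⟩ : ∃ p : K[X], algebraMap K[X] (RatFunc K) p = z := by
    obtain ⟨e, he, he0⟩ := Submodule.exists_mem_ne_zero_of_ne_bot E.2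
    obtain ⟨q, hq⟩ := mem_polyExtension_top.1 (hA (hE e he))
    refine ⟨q * C e⁻¹, ?_⟩
    rw [map_mul, hq, mul_assoc, ← map_mul, ← C_mul, mul_inv_cancel₀ he0, C_1, map_one, mul_one]
  rw [← map_mul, algebraMap_mem_polyExtension]
  intro n
  rw [coeff_mul_C]
  by_cases hn : p.coeff n = 0
  · rw [hn, zero_mul]
    exact Submodule.zero_mem _
  -- Each coefficient `p_n` of `z` satisfies `p_n E ⊆ c(zE[X])`, whence `p_n c ∈ c(zE[X])^S`.
  have hle : E.dilate (p.coeff n) hn ≤ (E.poly.dilate _ hz).content hA := by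
    rintro _ ⟨e, he, rfl⟩
    have := hE e he
    rw [← map_mul] at this
    have := coeff_mem_contentSubmodule this n
    rwa [coeff_mul_C] at this
  refine S.mono _ _ hle ?_
  rw [S.map_dilate]
  exact ⟨c, hc, rfl⟩

/-- The finite-type operation associated to `▲^S` strictly extends the one associated to `S`. -/
theorem isStrictExtension_finType_maxExt (S : SemistarOperation D K) :
    S.maxExt.finType.IsStrictExtension S.finType := by
  intro E
  refine le_antisymm ?_ (polyExtension_le ?_)
  · rintro f ⟨F, hF, hFE, hf⟩
    have hFtop : F.1 ≤ polyExtension ⊤ := le_trans hFE (polyExtension_mono le_top)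
    refine polyExtension_mono (fun c hc => ?_) (mem_polyExtension_of_mem_maxExt hFtop hf)
    exact ⟨F.content hFtop, fg_contentSubmodule hFtop hF, contentSubmodule_le hFE, hc⟩
  · rintro c ⟨F, hF, hFE, hc⟩
    exact ⟨F.poly, fg_polyExtension hF, polyExtension_mono hFE, C_mem_maxExt_poly hc⟩

/-- Apply `T` to `zA ⊆ c(zA)[X]`: strictness turns the right side into `c(zA)^S[X]`, for every
admissible `z`. -/
theorem IsStrictExtension.le_maxExt {T : SemistarOperation D[X] (RatFunc K)}
    {S : SemistarOperation D K} (hT : T.IsStrictExtension S) : T ≤ S.maxExt := by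
  intro A f hf
  refine mem_maxExt.2 fun z hz hA => ?_
  have hle : A.dilate z hz ≤ ((A.dilate z hz).content hA).poly :=
    le_polyExtension_contentSubmodule hA
  have hmem : z * f ∈ (T (A.dilate z hz)).1 := by
    rw [T.map_dilate]
    exact ⟨f, hf, rfl⟩
  have := T.mono _ _ hle hmem
  rwa [hT] at this

theorem isGreatest_finType_maxExt (S : SemistarOperation D K) :
    IsGreatest {T : SemistarOperation D[X] (RatFunc K) |
      T.IsFiniteType ∧ T.IsStrictExtension S.finType} S.maxExt.finType := by
  refine ⟨⟨isFiniteType_finType _, S.isStrictExtension_finType_maxExt⟩, ?_⟩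
  rintro T ⟨hfin, hT⟩
  exact hfin.le_finType fun F _ =>
    (hT.le_maxExt.trans (maxExt_mono S.finType_le)) F

/-! ### Dense ideals of `D[X]` and the stable part of `▲^S` -/

variable [IsFractionRing D K]

theorem IsDense.map_C {S : SemistarOperation D K} {J : Ideal D} (hJ : S.IsDense J) :
    S.maxExt.IsDense (J.map C) := by
  obtain ⟨hJ0, h1⟩ := hJ
  have h0 : J.map (C : D →+* D[X]) ≠ ⊥ := by
    rwa [Ne, Ideal.map_eq_bot_iff_of_injective C_injective]
  refine ⟨h0, ?_⟩
  have hle : (NonzeroSubmodule.ofIdeal (K := K) J hJ0).poly ≤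
      NonzeroSubmodule.ofIdeal (J.map C) h0 := by
    refine polyExtension_le ?_
    rintro _ ⟨d, hd, rfl⟩
    refine ⟨C d, Ideal.mem_map_of_mem _ hd, ?_⟩
    rw [Algebra.linearMap_apply, algebraMap_polynomial_ratFunc, Polynomial.map_C,
      Algebra.linearMap_apply]
  have := S.maxExt.mono _ _ hle (C_mem_maxExt_poly h1)
  rwa [C_1, map_one] at this

/-- If `J` is dense for `▲^S`, then only polynomials multiply `J` into `K[X]`. -/
theorem IsDense.mem_range_of_dilate_le {S : SemistarOperation D K} {J : Ideal D[X]}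
    (hJ : S.maxExt.IsDense J) {z : RatFunc K}
    (h : ∀ g ∈ J, g • z ∈ polyExtension (⊤ : Submodule D K)) :
    ∃ p : K[X], algebraMap K[X] (RatFunc K) p = z := by
  obtain ⟨hJ0, h1⟩ := hJ
  have hinj := IsFractionRing.injective K[X] (RatFunc K)
  obtain ⟨h₀, hI⟩ : ∃ h₀ : K[X],
      -- `K[X]` is a principal ideal ring; the aim is that `h₀` is a unit, so that `J` generates
      -- `K[X]`.
      J.map (mapRingHom (algebraMap D K)) = Ideal.span {h₀} :=
    (IsPrincipalIdealRing.principal (J.map (mapRingHom (algebraMap D K)))).principal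
  have hmem : ∀ g ∈ J, h₀ ∣ g.map (algebraMap D K) := fun g hg => by
    rw [← Ideal.mem_span_singleton, ← hI]
    exact Ideal.mem_map_of_mem (mapRingHom (algebraMap D K)) hg
  have hh0 : h₀ ≠ 0 := by
    rintro rfl
    refine hJ0 ((Submodule.eq_bot_iff _).2 fun g hg => ?_)
    have := zero_dvd_iff.1 (hmem g hg)
    exact Polynomial.map_injective _ (IsFractionRing.injective D K) (by simpa using this)
  have hh0' : algebraMap K[X] (RatFunc K) h₀ ≠ 0 := by simpa using hh0
  obtain ⟨q, hq⟩ : ∃ q : K[X],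
      algebraMap K[X] (RatFunc K) q = (algebraMap K[X] (RatFunc K) h₀)⁻¹ := by
    -- Since `h₀⁻¹ J ⊆ K[X]`, testing `1 ∈ J^▲` against `h₀⁻¹` shows that `h₀⁻¹` is a polynomial.
    have := mem_maxExt.1 h1 _ (inv_ne_zero hh0') (by
      rintro _ ⟨_, ⟨g, hg, rfl⟩, rfl⟩
      obtain ⟨r, hr⟩ := hmem g hg
      refine mem_polyExtension_top.2 ⟨r, ?_⟩
      change _ = (algebraMap K[X] (RatFunc K) h₀)⁻¹ * algebraMap D[X] (RatFunc K) g
      rw [algebraMap_polynomial_ratFunc, hr, map_mul, inv_mul_cancel_left₀ hh0'])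
    rw [mul_one] at this
    exact mem_polyExtension_top.1 (polyExtension_mono le_top this)
  -- `L` consists of the polynomials multiplying `z` into `K[X]`; it contains `J`, hence `1`.
  let L : Ideal K[X] :=
    (LinearMap.range (Algebra.linearMap K[X] (RatFunc K))).comap
      (LinearMap.toSpanSingleton K[X] (RatFunc K) z)
  have hL : J.map (mapRingHom (algebraMap D K)) ≤ L := by
    refine Ideal.map_le_iff_le_comap.2 fun g hg => ?_
    obtain ⟨p, hp⟩ := mem_polyExtension_top.1 (h g hg)
    refine ⟨p, ?_⟩
    rw [Algebra.linearMap_apply, hp, Algebra.smul_def, algebraMap_polynomial_ratFunc,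
      ← Algebra.smul_def]
    rfl
  have h1L : (1 : K[X]) ∈ L := by
    refine hL ?_
    rw [hI, Ideal.mem_span_singleton]
    refine ⟨q, hinj ?_⟩
    rw [map_mul, hq, mul_inv_cancel₀ hh0', map_one]
  obtain ⟨p, hp⟩ := h1L
  refine ⟨p, ?_⟩
  rw [Algebra.linearMap_apply] at hp
  rw [hp, LinearMap.toSpanSingleton_apply, one_smul]

theorem IsDense.maxExt_stableFinType {S : SemistarOperation D K} {J : Ideal D[X]}
    (hfg : J.FG) (hJ : S.maxExt.IsDense J) : S.stableFinType.maxExt.IsDense J := by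
  obtain ⟨hJ0, h1⟩ := id hJ
  obtain ⟨s, hs⟩ := hfg
  obtain ⟨f, hfJ, hf⟩ := exists_mem_span_contentIdeal s
  have hs' : Ideal.span (s : Set D[X]) = J := hs
  rw [hs'] at hfJ hf
  -- `J ⊆ c(f)[X]`, so testing `1 ∈ J^▲` against `z = 1` yields `1 ∈ c(f)^S`.
  have hfd : S.IsDense f.contentIdeal := by
    have hf0 : f.contentIdeal ≠ ⊥ := by
      intro h0
      refine hJ0 ((Submodule.eq_bot_iff _).2 fun g hg => Polynomial.ext fun n => ?_)
      simpa [h0] using hf g hg n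
    have hle : (NonzeroSubmodule.ofIdeal (K := RatFunc K) J hJ0).1 ≤
        polyExtension (NonzeroSubmodule.ofIdeal (K := K) f.contentIdeal hf0).1 := by
      rintro _ ⟨g, hg, rfl⟩
      refine ⟨g.map (algebraMap D K), fun n => ⟨g.coeff n, hf g hg n, ?_⟩, ?_⟩
      · rw [coeff_map, Algebra.linearMap_apply]
      · rw [Algebra.linearMap_apply, algebraMap_polynomial_ratFunc]
    have htop := hle.trans (polyExtension_mono le_top)
    have hC : algebraMap K[X] (RatFunc K) (C 1) = 1 := by rw [C_1, map_one]
    rw [← hC] at h1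
    have := algebraMap_mem_polyExtension.1 (mem_polyExtension_of_mem_maxExt htop h1) 0
    rw [coeff_C_zero] at this
    exact ⟨hf0, S.mono _ _ (contentSubmodule_le hle) this⟩
  refine ⟨hJ0, mem_maxExt.2 fun z hz hA => ?_⟩
  have hmem : ∀ g ∈ J, g • z ∈
      ((NonzeroSubmodule.ofIdeal (K := RatFunc K) J hJ0).dilate z hz).1 := fun g hg => by
    rw [Algebra.smul_def, mul_comm]
    exact ⟨_, ⟨g, hg, rfl⟩, rfl⟩
  obtain ⟨p, rfl⟩ := hJ.mem_range_of_dilate_le fun g hg => hA (hmem g hg)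
  -- As `fz ∈ zJ`, this gives `c(f)^N c(z) ⊆ c(zJ)`, and `c(f)^N` is a finitely generated dense
  -- ideal.
  obtain ⟨N, hN⟩ := exists_contentIdeal_pow_smul_coeff_mem f p
    (((NonzeroSubmodule.ofIdeal (K := RatFunc K) J hJ0).dilate _ hz).content hA).1 (fun n => by
      have := hmem f hfJ
      rw [polynomial_smul_algebraMap] at this
      exact coeff_mem_contentSubmodule this n)
  rw [mul_one, algebraMap_mem_polyExtension]
  exact fun n => mem_stableFinType.2 ⟨_, Submodule.FG.pow f.contentIdeal_FG N, hfd.pow N,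
    fun d hd => hN d hd n⟩

theorem stableFinType_maxExt_eq (S : SemistarOperation D K) :
    S.maxExt.stableFinType = S.stableFinType.maxExt.stableFinType :=
  le_antisymm (stableFinType_mono_of_isDense fun _ hfg hJ => hJ.maxExt_stableFinType hfg)
    (stableFinType_mono_of_isDense fun _ _ hJ => hJ.mono (maxExt_mono S.stableFinType_le) le_rfl)

theorem isStrictExtension_stableFinType_maxExt (S : SemistarOperation D K) :
    S.maxExt.stableFinType.IsStrictExtension S.stableFinType := by
  intro E
  refine le_antisymm ?_ (polyExtension_le fun x hx => ?_)
  · have hle : S.stableFinType.maxExt.stableFinType ≤ S.stableFinType.maxExt.finType :=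
      (isFiniteType_stableFinType _).le_finType fun F _ => stableFinType_le _ _
    have h := S.stableFinType.isStrictExtension_finType_maxExt E
    rw [← S.isFiniteType_stableFinType] at h
    rw [stableFinType_maxExt_eq, ← h]
    exact hle E.poly
  · obtain ⟨J, hfg, hJ, hJx⟩ := mem_stableFinType.1 hx
    -- For the lower bound, `Jx ⊆ E` extends to `J[X]x ⊆ E[X]`, and `J[X]` is dense for `▲^S`.
    have hle : J.map C ≤ colonIdeal E.poly.1 (algebraMap K[X] (RatFunc K) (C x)) := by
      refine Ideal.map_le_iff_le_comap.2 fun d hd => ?_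
      rw [Ideal.mem_comap, mem_colonIdeal, polynomial_smul_algebraMap, Polynomial.map_C, ← C_mul, ← Algebra.smul_def]
      exact C_mem_polyExtension (hJx d hd)
    exact mem_stableFinType.2 ⟨J.map C, Ideal.FG.map hfg C, hJ.map_C, fun g hg => hle hg⟩

theorem isGreatest_stableFinType_maxExt (S : SemistarOperation D K) :
    IsGreatest {T : SemistarOperation D[X] (RatFunc K) |
      T.IsStable ∧ T.IsFiniteType ∧ T.IsStrictExtension S.stableFinType}
      S.maxExt.stableFinType := by
  refine ⟨⟨isStable_stableFinType _, isFiniteType_stableFinType _,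
    S.isStrictExtension_stableFinType_maxExt⟩, ?_⟩
  rintro T ⟨hstab, hfin, hT⟩
  -- `T` extends `S̃`, so `T ≤ ▲^{S̃}`, and dense ideals for `T` are dense for `▲^{S̃}`.
  rw [stableFinType_maxExt_eq]
  exact (hstab.le_stableFinType hfin).trans
    (stableFinType_mono_of_isDense fun _ _ hJ => hJ.mono hT.le_maxExt le_rfl)

end SemistarOperation

theorem theorem2p3 {D K : Type*} [CommRing D] [IsDomain D] [Field K] [Algebra D K]
    [IsFractionRing D K] (S : SemistarOperation D K) :
    (S.maxExt.finType = S.finType.maxExt.finType ∧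
      IsGreatest {T : SemistarOperation D[X] (RatFunc K) |
        T.IsFiniteType ∧ T.IsStrictExtension S.finType} S.maxExt.finType) ∧
    (S.maxExt.stableFinType = S.stableFinType.maxExt.stableFinType ∧
      IsGreatest {T : SemistarOperation D[X] (RatFunc K) |
        T.IsStable ∧ T.IsFiniteType ∧ T.IsStrictExtension S.stableFinType}
        S.maxExt.stableFinType) :=
  ⟨⟨SemistarOperation.finType_congr fun _ hF => (S.maxExt_finType_apply hF).symm,
    S.isGreatest_finType_maxExt⟩,
    S.stableFinType_maxExt_eq, S.isGreatest_stableFinType_maxExt⟩
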